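/- Let $m\ge 0$ and let $G$ be the straight linear 2-tree with $n=m+2$ vertices, that is, the graph with vertex set $\{1,\dots,n\}$ in which $u$ and $v$ are adjacent if and only if $0<|u-v|\le 2$. Let $j\ge 1$ and $k\ge 1$ be integers with $j+k\le n$. A spanning 2-forest of $G$ is an acyclic subgraph of $G$ that contains all vertices of $G$ and has exactly two connected components; it separates two vertices if they lie in different components. Let $F_p$ ($p\in\mathbb Z$) be the Fibonacci numbers, $F_0=0$, $F_1=1$, $F_{p+2}=F_{p+1}+F_p$ (so $F_{-p}=(-1)^{p+1}F_p$), and let $L_p$ be the Lucas numbers, $L_0=2$, $L_1=1$, $L_{p+2}=L_{p+1}+L_p$. Then the number of spanning 2-forests of $G$ that separate the vertices $j$ and $j+k$ is \[ \sum_{i=1}^{k}\left[F_iF_{i+2j-2}-F_{i-1}F_{i+2j-3}\right]F_{2m-2i-2j+5} = F_{m+1}^2+F_k^2F_{m-2j-k+3}^2+\frac{F_{m+1}}{5}\left(F_{m-k}(kL_k-F_k)+F_{m-k+1}\bigl((k-5)F_{k+1}+(2k+2)F_k\bigr)\right). \] -/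

import Mathlib

namespace StraightTwoTree

/-- The straight linear 2-tree on `n` vertices: its adjacency matrix has ones exactly on the first
and second sub- and superdiagonals. The vertex labelled `v ∈ {1, …, n}` is `v - 1 : Fin n`. -/
def straightLinearTwoTree (n : ℕ) : SimpleGraph (Fin n) where
  Adj u v := (u : ℕ) + 1 = v ∨ (u : ℕ) + 2 = v ∨ (v : ℕ) + 1 = u ∨ (v : ℕ) + 2 = u
  symm := ⟨fun u v h => by omega⟩
  loopless := ⟨fun u h => by omega⟩

/-- `H` is a spanning 2-forest of `G`: a subgraph of `G` on the whole vertex set of `G` that has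
no cycle and has exactly two connected components. -/
def IsSpanningTwoForest {V : Type*} (G H : SimpleGraph V) : Prop :=
  H ≤ G ∧ H.IsAcyclic ∧ Nat.card H.ConnectedComponent = 2

/-- The number of spanning 2-forests of `G` in which `u` and `v` lie in different components. -/
noncomputable def numSeparatingTwoForests {V : Type*} (G : SimpleGraph V) (u v : V) : ℕ :=
  {H : SimpleGraph V | IsSpanningTwoForest G H ∧
    H.connectedComponentMk u ≠ H.connectedComponentMk v}.ncard

/-- The Lucas numbers `2, 1, 3, 4, 7, 11, …`. -/
def lucas : ℕ → ℤ
  | 0 => 2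
  | 1 => 1
  | n + 2 => lucas n + lucas (n + 1)

end StraightTwoTree

namespace StraightTwoTree

open SimpleGraph

/-! Identifying `u` with `v` turns the forests that separate them into the spanning trees of the
quotient graph, and deletion-contraction counts those. `ncard_forestsBetween` makes this precise:
contraction is recorded only as a labelling of the vertices, and `treeCount` runs through the edge
list.

In the straight 2-tree the first vertex carries just two edges, so removing it leaves a shorter
2-tree of the same kind. This gives a closed linear system for the count and for its variant with
the first edge contracted.

The closed form, parametrised by the numbers of vertices before (`j`), between (`k`, the distance)
and after (`r`), satisfies the same system. Addition formulas turn it into a polynomial in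
neighbouring Fibonacci numbers, so each recurrence becomes a `ring` identity. The sum in the
statement telescopes to the same closed form. -/

/-- Number of ways to choose edges from the list `l` which, after identifying vertices with
equal label under `f`, form a spanning tree on the classes of `S`. -/
def treeCount {V : Type*} (S : Finset V) : List (V × V) → (V → ℕ) → ℕ
  | [], f => if ∀ x ∈ S, ∀ y ∈ S, f x = f y then 1 else 0
  | (a, b) :: l, f => treeCount S l f +
      if f a = f b then 0 else treeCount S l (fun x => if f x = f a then f b else f x)

/-! ### Separating forests and deletion-contraction -/

section Graph

variable {V : Type*}

theorem reachable_sup_edge_iff (G : SimpleGraph V) (a b x y : V) :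
    (G ⊔ edge a b).Reachable x y ↔ G.Reachable x y ∨
      (G.Reachable x a ∧ G.Reachable b y) ∨ (G.Reachable x b ∧ G.Reachable a y) := by
  have hab : (G ⊔ edge a b).Reachable a b := by
    by_cases h : a = b
    · exact h ▸ Reachable.refl _
    · exact Adj.reachable (Or.inr (by simp [edge_adj, h]))
  constructor
  · rintro ⟨w⟩
    induction w with
    | nil => exact Or.inl (Reachable.refl _)
    | cons h p ih =>
      rcases h with h | h
      · have := h.reachable
        rcases ih with ih | ⟨h1, h2⟩ | ⟨h1, h2⟩
        · exact Or.inl (this.trans ih)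
        · exact Or.inr (Or.inl ⟨this.trans h1, h2⟩)
        · exact Or.inr (Or.inr ⟨this.trans h1, h2⟩)
      · rw [edge_adj] at h
        obtain ⟨⟨rfl, rfl⟩ | ⟨rfl, rfl⟩, -⟩ := h
        · rcases ih with ih | ⟨h1, h2⟩ | ⟨h1, h2⟩
          · exact Or.inr (Or.inl ⟨Reachable.refl _, ih⟩)
          · exact Or.inr (Or.inl ⟨Reachable.refl _, h2⟩)
          · exact Or.inl h2
        · rcases ih with ih | ⟨h1, h2⟩ | ⟨h1, h2⟩
          · exact Or.inr (Or.inr ⟨Reachable.refl _, ih⟩)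
          · exact Or.inl h2
          · exact Or.inr (Or.inr ⟨Reachable.refl _, h2⟩)
  · have hle : G ≤ G ⊔ edge a b := le_sup_left
    rintro (h | ⟨h1, h2⟩ | ⟨h1, h2⟩)
    · exact h.mono hle
    · exact ((h1.mono hle).trans hab).trans (h2.mono hle)
    · exact ((h1.mono hle).trans hab.symm).trans (h2.mono hle)

/-- `H` is a forest whose components are those of `u` and `v`, which are different. -/
def IsSeparatingForest (u v : V) (H : SimpleGraph V) : Prop :=
  H.IsAcyclic ∧ ¬ H.Reachable u v ∧ ∀ x, H.Reachable u x ∨ H.Reachable v x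

theorem isSpanningTwoForest_and_ne_iff (G H : SimpleGraph V) (u v : V) :
    (IsSpanningTwoForest G H ∧ H.connectedComponentMk u ≠ H.connectedComponentMk v) ↔
      IsSeparatingForest u v H ∧ H ≤ G := by
  unfold IsSpanningTwoForest IsSeparatingForest
  rw [Ne, ConnectedComponent.eq]
  constructor
  · rintro ⟨⟨hle, hac, hc⟩, huv⟩
    refine ⟨⟨hac, huv, fun x => ?_⟩, hle⟩
    obtain ⟨c, d, -, hcd⟩ := Nat.card_eq_two_iff.1 hc
    have key : ∀ w, H.connectedComponentMk w = c ∨ H.connectedComponentMk w = d := fun w => by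
      have := Set.mem_univ (H.connectedComponentMk w)
      rw [← hcd] at this
      simpa using this
    rw [← ConnectedComponent.eq, ← ConnectedComponent.eq]
    rw [← ConnectedComponent.eq] at huv
    have h1 := key u
    have h2 := key v
    have h3 := key x
    grind
  · rintro ⟨⟨hac, huv, hx⟩, hle⟩
    refine ⟨⟨hle, hac, ?_⟩, huv⟩
    refine Nat.card_eq_two_iff.2 ⟨H.connectedComponentMk u, H.connectedComponentMk v, ?_, ?_⟩
    · rwa [Ne, ConnectedComponent.eq]
    · refine Set.eq_univ_of_forall fun c => ?_
      induction c using ConnectedComponent.ind with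
      | h x => simpa [ConnectedComponent.eq, reachable_comm] using hx x

theorem not_reachable_of_le {H K : SimpleGraph V} {u v : V} (h : H ≤ K) (hK : ¬ K.Reachable u v) :
    ¬ H.Reachable u v := fun h' => hK (h'.mono h)

/-- Separating forests containing `K` whose remaining edges are taken from the list `l`. -/
def forestsBetween (u v : V) (K : SimpleGraph V) (l : List (V × V)) : Set (SimpleGraph V) :=
  {H | IsSeparatingForest u v H ∧ K ≤ H ∧
    ∀ x y, H.Adj x y → K.Adj x y ∨ (x, y) ∈ l ∨ (y, x) ∈ l}

theorem forestsBetween_cons (u v : V) (K : SimpleGraph V) (a b : V) (l : List (V × V))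
    (hab : a ≠ b) :
    forestsBetween u v K ((a, b) :: l) =
      (forestsBetween u v K ((a, b) :: l) ∩ {H | ¬ H.Adj a b}) ∪
        forestsBetween u v (K ⊔ edge a b) l := by
  ext H
  simp only [forestsBetween, Set.mem_union, Set.mem_inter_iff, Set.mem_ofPred_eq, List.mem_cons,
    Prod.mk.injEq, sup_adj, edge_adj, sup_le_iff, edge_le_iff]
  by_cases h : H.Adj a b
  · simp only [h, not_true, and_false, false_or, or_true, and_true]
    refine and_congr_right fun _ => and_congr_right fun _ => forall₂_congr fun x y => ?_
    refine imp_congr_right fun hxy => ?_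
    have := hxy.ne
    tauto
  · simp [h, hab]

theorem forestsBetween_cons_inter (u v : V) (K : SimpleGraph V) (a b : V) (l : List (V × V))
    (hK : ¬ K.Adj a b) (h1 : (a, b) ∉ l) (h2 : (b, a) ∉ l) :
    forestsBetween u v K ((a, b) :: l) ∩ {H | ¬ H.Adj a b} = forestsBetween u v K l := by
  ext H
  simp only [forestsBetween, Set.mem_inter_iff, Set.mem_ofPred_eq, List.mem_cons, Prod.mk.injEq]
  constructor
  · rintro ⟨⟨hg, hle, h⟩, hn⟩
    refine ⟨hg, hle, fun x y hxy => ?_⟩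
    rcases h x y hxy with h | (⟨rfl, rfl⟩ | h) | (⟨rfl, rfl⟩ | h)
    · exact Or.inl h
    · exact absurd hxy hn
    · exact Or.inr (Or.inl h)
    · exact absurd hxy.symm hn
    · exact Or.inr (Or.inr h)
  · rintro ⟨hg, hle, h⟩
    refine ⟨⟨hg, hle, fun x y hxy => ?_⟩, fun hn => ?_⟩
    · have := h x y hxy
      tauto
    · have := h a b hn
      tauto

/-- Invariant: the classes of `f` are the components of `K` after joining `u` to `v`. An edge inside
one class would close a cycle or connect `u` to `v`, so no separating forest extends `K` by it; any
other edge may be deleted or contracted. -/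
theorem ncard_forestsBetween [Fintype V] (u v : V) (l : List (V × V)) :
    ∀ (K : SimpleGraph V) (f : V → ℕ), (l.map fun p => s(p.1, p.2)).Nodup →
      (∀ p ∈ l, p.1 ≠ p.2 ∧ ¬ K.Adj p.1 p.2) → K.IsAcyclic → ¬ K.Reachable u v →
      (∀ x y, f x = f y ↔ (K ⊔ edge u v).Reachable x y) →
      (forestsBetween u v K l).ncard = treeCount Finset.univ l f := by
  induction l with
  | nil =>
    intro K f _ _ hac huv hf
    have hset : forestsBetween u v K [] = {H | H = K ∧ ∀ x, K.Reachable u x ∨ K.Reachable v x} := by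
      ext H
      simp only [forestsBetween, Set.mem_ofPred_eq, List.not_mem_nil, or_false]
      constructor
      · rintro ⟨hg, hle, h⟩
        obtain rfl : H = K := le_antisymm (fun x y => h x y) hle
        exact ⟨rfl, hg.2.2⟩
      · rintro ⟨rfl, h⟩
        exact ⟨⟨hac, huv, h⟩, le_rfl, fun _ _ => id⟩
    have hiff : (∀ x ∈ Finset.univ, ∀ y ∈ Finset.univ, f x = f y) ↔
        ∀ x, K.Reachable u x ∨ K.Reachable v x := by
      simp only [Finset.mem_univ, true_imp_iff, hf, reachable_sup_edge_iff]
      constructor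
      · intro h x
        rcases h u x with h | ⟨_, h⟩ | ⟨_, h⟩
        · exact Or.inl h
        · exact Or.inr h
        · exact Or.inl h
      · intro h x y
        rcases h x with h1 | h1 <;> rcases h y with h2 | h2
        · exact Or.inl (h1.symm.trans h2)
        · exact Or.inr (Or.inl ⟨h1.symm, h2⟩)
        · exact Or.inr (Or.inr ⟨h1.symm, h2⟩)
        · exact Or.inl (h1.symm.trans h2)
    rw [hset, treeCount]
    by_cases h : ∀ x, K.Reachable u x ∨ K.Reachable v x
    · rw [if_pos (hiff.2 h)]
      simp only [h, implies_true, and_true, Set.ofPred_eq_eq_singleton, Set.ncard_singleton]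
    · rw [if_neg (fun h' => h (hiff.1 h'))]
      simp only [h, and_false, Set.ofPred_false, Set.ncard_empty]
  | cons p l ih =>
    obtain ⟨a, b⟩ := p
    intro K f hnd hl hac huv hf
    rw [List.map_cons, List.nodup_cons] at hnd
    obtain ⟨hnot, hnd⟩ := hnd
    have h1 : (a, b) ∉ l := fun h => hnot (List.mem_map.2 ⟨_, h, rfl⟩)
    have h2 : (b, a) ∉ l := fun h => hnot (List.mem_map.2 ⟨_, h, Sym2.eq_swap⟩)
    obtain ⟨hab, hKab⟩ := hl (a, b) List.mem_cons_self
    have hl' : ∀ p ∈ l, p.1 ≠ p.2 ∧ ¬ K.Adj p.1 p.2 := fun p hp => hl p (List.mem_cons_of_mem _ hp)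
    have ih1 := ih K f hnd hl' hac huv hf
    rw [forestsBetween_cons u v K a b l hab, forestsBetween_cons_inter u v K a b l hKab h1 h2,
      Set.ncard_union_eq ?_ (Set.toFinite _) (Set.toFinite _), ih1, treeCount]
    · congr 1
      split_ifs with hfab
      · rw [hf, reachable_sup_edge_iff] at hfab
        rw [Set.ncard_eq_zero (Set.toFinite _)]
        refine Set.eq_empty_of_forall_notMem ?_
        rintro H ⟨⟨hHac, hHuv, -⟩, hle, -⟩
        have hac' := hHac.anti hle
        have huv' := not_reachable_of_le hle hHuv
        rw [isAcyclic_sup_fromEdgeSet_iff] at hac'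
        rw [reachable_sup_edge_iff] at huv'
        rcases hfab with h | ⟨h3, h4⟩ | ⟨h3, h4⟩
        · exact (hac'.2 h).elim hab hKab
        · exact huv' (Or.inr (Or.inl ⟨h3.symm, h4.symm⟩))
        · exact huv' (Or.inr (Or.inr ⟨h4, h3⟩))
      · have hfab' := hfab
        rw [hf] at hfab'
        have hKr : ¬ K.Reachable a b := not_reachable_of_le le_sup_left hfab'
        refine ih _ _ hnd ?_ ?_ ?_ ?_
        · intro p hp
          refine ⟨(hl' p hp).1, ?_⟩
          rw [sup_adj, edge_adj]
          rintro (h | ⟨⟨h3, h4⟩ | ⟨h3, h4⟩, -⟩)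
          · exact (hl' p hp).2 h
          · exact h1 (by rw [← h3, ← h4]; exact hp)
          · exact h2 (by rw [← h3, ← h4]; exact hp)
        · exact hac.sup_edge_of_not_reachable hKr
        · rw [reachable_sup_edge_iff]
          rw [reachable_sup_edge_iff] at hfab'
          rintro (h | ⟨h3, h4⟩ | ⟨h3, h4⟩)
          · exact huv h
          · exact hfab' (Or.inr (Or.inl ⟨h3.symm, h4.symm⟩))
          · exact hfab' (Or.inr (Or.inr ⟨h4, h3⟩))
        · intro x y
          -- Adding the edge `ab` after gluing `u` to `v` merges exactly the classes of `a` and `b`,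
          -- so the invariant persists.
          rw [sup_right_comm, reachable_sup_edge_iff]
          simp only [← hf]
          grind
    · rw [← forestsBetween_cons_inter u v K a b l hKab h1 h2, Set.disjoint_left]
      rintro H ⟨-, hn⟩ ⟨-, hle, -⟩
      exact hn (hle (Or.inr (by simp [edge_adj, hab])))

theorem treeCount_map {W : Type*} (e : V ↪ W) (S : Finset V) (l : List (V × V)) :
    ∀ f : W → ℕ, treeCount (S.map e) (l.map (Prod.map e e)) f = treeCount S l (f ∘ e) := by
  induction l with
  | nil => intro f; simp [treeCount]
  | cons p l ih =>
    intro f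
    simp only [List.map_cons, Prod.map, treeCount, Function.comp_apply]
    rw [ih, ih]
    rfl

end Graph

/-! ### Recurrences from removing the first vertex -/

section Ladder

/-- Identify the classes of `a` and `b`. -/
def merge {V : Type*} (f : V → ℕ) (a b : V) : V → ℕ := fun x => if f x = f a then f b else f x

theorem treeCount_cons {V : Type*} (S : Finset V) (a b : V) (l : List (V × V)) (f : V → ℕ) :
    treeCount S ((a, b) :: l) f =
      treeCount S l f + if f a = f b then 0 else treeCount S l (merge f a b) := rfl

/-- Only the partition induced on `T` matters once every class meets `T` and all edges lie in `T`.
This permits dropping the first vertex and changing labels freely. -/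
theorem treeCount_restrict {V : Type*} {S T : Finset V} (hTS : T ⊆ S) (l : List (V × V)) :
    ∀ {f g : V → ℕ}, (∀ p ∈ l, p.1 ∈ T ∧ p.2 ∈ T) → (∀ x ∈ S, ∃ y ∈ T, f x = f y) →
      (∀ x ∈ T, ∀ y ∈ T, f x = f y ↔ g x = g y) → treeCount S l f = treeCount T l g := by
  induction l with
  | nil =>
    intro f g _ hS hfg
    have : (∀ x ∈ S, ∀ y ∈ S, f x = f y) ↔ ∀ x ∈ T, ∀ y ∈ T, g x = g y := by
      constructor
      · intro h x hx y hy
        exact (hfg x hx y hy).1 (h x (hTS hx) y (hTS hy))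
      · intro h x hx y hy
        obtain ⟨x', hx', ex⟩ := hS x hx
        obtain ⟨y', hy', ey⟩ := hS y hy
        rw [ex, ey]
        exact (hfg x' hx' y' hy').2 (h x' hx' y' hy')
    simp only [treeCount, this]
  | cons p l ih =>
    obtain ⟨a, b⟩ := p
    intro f g hl hS hfg
    have hab := hl (a, b) List.mem_cons_self
    have hl' : ∀ p ∈ l, p.1 ∈ T ∧ p.2 ∈ T := fun p hp => hl p (List.mem_cons_of_mem _ hp)
    rw [treeCount_cons, treeCount_cons, ih hl' hS hfg]
    have hfgab := hfg a hab.1 b hab.2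
    congr 1
    by_cases h : f a = f b
    · rw [if_pos h, if_pos (hfgab.1 h)]
    · rw [if_neg h, if_neg (fun h' => h (hfgab.2 h'))]
      refine ih hl' ?_ ?_
      · intro x hx
        obtain ⟨y, hy, e⟩ := hS x hx
        exact ⟨y, hy, by simp only [merge, e]⟩
      · intro x hx y hy
        have h1 := hfg x hx y hy
        have h2 := hfg x hx a hab.1
        have h3 := hfg y hy a hab.1
        have h4 := hfg x hx b hab.2
        have h5 := hfg y hy b hab.2
        simp only [merge]
        grind

theorem treeCount_eq_zero {V : Type*} {S : Finset V} {a b : V} (ha : a ∈ S) (hb : b ∈ S)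
    (l : List (V × V)) : ∀ {f : V → ℕ}, (∀ p ∈ l, f p.1 ≠ f a ∧ f p.2 ≠ f a) → f b ≠ f a →
      treeCount S l f = 0 := by
  induction l with
  | nil =>
    intro f _ hf
    rw [treeCount, if_neg fun h => hf (h b hb a ha)]
  | cons p l ih =>
    obtain ⟨c, d⟩ := p
    intro f hl hf
    have hcd := hl (c, d) List.mem_cons_self
    have hl' : ∀ p ∈ l, f p.1 ≠ f a ∧ f p.2 ≠ f a := fun p hp => hl p (List.mem_cons_of_mem _ hp)
    rw [treeCount_cons, ih hl' hf, ih]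
    · simp
    · intro p hp
      have := hl' p hp
      simp only [merge]
      grind
    · simp only [merge]
      grind

/-- Edges of the straight linear 2-tree on the vertices `a, …, a + N`. -/
def ladder : ℕ → ℕ → List (ℕ × ℕ)
  | _, 0 => []
  | a, 1 => [(a, a + 1)]
  | a, N + 2 => (a, a + 1) :: (a, a + 2) :: ladder (a + 1) (N + 1)

theorem mem_ladder (N : ℕ) : ∀ (a : ℕ) (p : ℕ × ℕ), p ∈ ladder a N ↔
    a ≤ p.1 ∧ p.2 ≤ a + N ∧ (p.2 = p.1 + 1 ∨ p.2 = p.1 + 2) := by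
  induction N using Nat.twoStepInduction with
  | zero => intro a p; simp only [ladder, List.not_mem_nil, false_iff]; omega
  | one =>
    rintro a ⟨x, y⟩
    simp only [ladder, List.mem_cons, List.not_mem_nil, Prod.mk.injEq, or_false]
    omega
  | more N _ ih =>
    rintro a ⟨x, y⟩
    simp only [ladder, List.mem_cons, ih, Prod.mk.injEq]
    omega

theorem nodup_ladder (N : ℕ) : ∀ a : ℕ, (ladder a N).Nodup := by
  induction N using Nat.twoStepInduction with
  | zero => intro a; simp [ladder]
  | one => intro a; simp [ladder]
  | more N _ ih =>
    intro a
    simp [ladder, ih, mem_ladder]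

/-- Spanning trees of the straight linear 2-tree on `a, …, a + N` with labels `f` identified. -/
def ladderCount (a N : ℕ) (f : ℕ → ℕ) : ℕ := treeCount (Finset.Icc a (a + N)) (ladder a N) f

/-- The same after contracting the edge from `a` to `a + 1`, or zero if that edge is a loop. -/
def contractedCount (a N : ℕ) (f : ℕ → ℕ) : ℕ :=
  if f a = f (a + 1) then 0 else ladderCount a N (merge f a (a + 1))

theorem treeCount_eq_ladderCount {a N b : ℕ} {f g : ℕ → ℕ} (hab : a < b) (hb : b ≤ a + N + 1)
    (hfab : f a = f b) (hfg : ∀ x y, a < x → a < y → (f x = f y ↔ g x = g y)) :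
    treeCount (Finset.Icc a (a + (N + 1))) (ladder (a + 1) N) f = ladderCount (a + 1) N g := by
  refine treeCount_restrict ?_ _ ?_ ?_ ?_
  · intro x; simp only [Finset.mem_Icc]; omega
  · intro p; simp only [mem_ladder, Finset.mem_Icc]; omega
  · intro x hx
    rw [Finset.mem_Icc] at hx
    rcases eq_or_lt_of_le hx.1 with rfl | h
    · exact ⟨b, by rw [Finset.mem_Icc]; omega, hfab⟩
    · exact ⟨x, by rw [Finset.mem_Icc]; omega, rfl⟩
  · intro x hx y hy
    rw [Finset.mem_Icc] at hx hy
    exact hfg x y (by omega) (by omega)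

theorem treeCount_isolated {a N : ℕ} {f : ℕ → ℕ} (hf : ∀ x, a < x → f x ≠ f a) :
    treeCount (Finset.Icc a (a + (N + 1))) (ladder (a + 1) N) f = 0 := by
  refine treeCount_eq_zero (a := a) (b := a + 1) ?_ ?_ _ ?_ (hf _ (by omega))
  · rw [Finset.mem_Icc]; omega
  · rw [Finset.mem_Icc]; omega
  · intro p hp
    rw [mem_ladder] at hp
    exact ⟨hf _ (by omega), hf _ (by omega)⟩

/-- Neither edge at `a` isolates it, either one alone makes it a leaf, and both together contract `a
+ 1` with `a + 2`. -/
theorem ladderCount_succ (a N : ℕ) {f : ℕ → ℕ} (hf : ∀ x, a < x → f x ≠ f a) :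
    ladderCount a (N + 2) f =
      2 * ladderCount (a + 1) (N + 1) f + contractedCount (a + 1) (N + 1) f := by
  have h1 := hf (a + 1) (by omega)
  have h2 := hf (a + 2) (by omega)
  have e1 : merge f a (a + 1) a = f (a + 1) := by simp [merge]
  have e2 : merge f a (a + 1) (a + 2) = f (a + 2) := by simp [merge, h2]
  rw [ladderCount, ladder, treeCount_cons, treeCount_cons, treeCount_cons, if_neg h1.symm,
    if_neg h2.symm, treeCount_isolated hf, e1, e2,
    treeCount_eq_ladderCount (f := merge f a (a + 2)) (g := f) (b := a + 2) (by omega) (by omega),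
    treeCount_eq_ladderCount (f := merge f a (a + 1)) (g := f) (b := a + 1) (by omega) (by omega),
    contractedCount]
  · have : (if f (a + 1) = f (a + 2) then 0 else
        treeCount (Finset.Icc a (a + (N + 2))) (ladder (a + 1) (N + 1))
          (merge (merge f a (a + 1)) a (a + 2))) =
        if f (a + 1) = f (a + 1 + 1) then 0 else
          ladderCount (a + 1) (N + 1) (merge f (a + 1) (a + 1 + 1)) := by
      split_ifs with h
      · rfl
      · rw [treeCount_eq_ladderCount (b := a + 1) (by omega) (by omega)]
        · simp [merge, h2]
        · intro x y hx hy
          simp only [merge, hf x hx, hf y hy, h2, if_true, if_false]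
    omega
  · simp [merge]
  · intro x y hx hy
    simp [merge, hf x hx, hf y hy]
  · simp [merge]
  · intro x y hx hy
    simp [merge, hf x hx, hf y hy]

/-- With `a` merged into `a + 1`, the first edge is a loop and the second is parallel to the edge
from `a + 1` to `a + 2`: it is either omitted or contracted. -/
theorem contractedCount_succ (a N : ℕ) {f : ℕ → ℕ} (hf : ∀ x, a < x → f x ≠ f a) :
    contractedCount a (N + 2) f =
      ladderCount (a + 1) (N + 1) f + contractedCount (a + 1) (N + 1) f := by
  have h1 := hf (a + 1) (by omega)
  have h2 := hf (a + 2) (by omega)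
  have e1 : merge f a (a + 1) a = f (a + 1) := by simp [merge]
  have e2 : merge f a (a + 1) (a + 2) = f (a + 2) := by simp [merge, h2]
  have e3 : merge f a (a + 1) (a + 1) = f (a + 1) := by simp [merge, h1]
  rw [contractedCount, if_neg h1.symm, ladderCount, ladder, treeCount_cons, treeCount_cons,
    e1, e2, e3, if_pos rfl,
    treeCount_eq_ladderCount (f := merge f a (a + 1)) (g := f) (b := a + 1) (by omega) (by omega),
    contractedCount, add_zero]
  · congr 1
    change _ = if f (a + 1) = f (a + 2) then 0 else _
    split_ifs with h
    · rfl
    · rw [treeCount_eq_ladderCount (b := a + 1) (by omega) (by omega)]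
      · simp [merge, h1]
      · intro x y hx hy
        simp only [merge, hf x hx, hf y hy, h2, if_true, if_false]
  · simp [merge, h1]
  · intro x y hx hy
    simp [merge, hf x hx, hf y hy]

/-- The identification of `u` with `v`. -/
def glue (u v : ℕ) : ℕ → ℕ := merge id u v

theorem glue_apply (u v x : ℕ) : glue u v x = if x = u then v else x := rfl

theorem glue_isolated {a u v : ℕ} (hu : a < u) (hv : u ≤ v) (x : ℕ) (hx : a < x) :
    glue u v x ≠ glue u v a := by
  simp only [glue_apply]
  split_ifs <;> omega

theorem ladderCount_glue_succ_self (a N : ℕ) :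
    ladderCount a N (glue a (a + 1)) = contractedCount a N id := by
  simp [contractedCount, glue]

theorem contractedCount_glue_succ_self (a N : ℕ) : contractedCount a N (glue a (a + 1)) = 0 := by
  simp [contractedCount, glue_apply]

theorem contractedCount_glue (a N k : ℕ) (hk : 1 ≤ k) :
    contractedCount a (N + 2) (glue a (a + 1 + k)) =
      ladderCount (a + 1) (N + 1) (glue (a + 1) (a + 1 + k)) +
        contractedCount (a + 1) (N + 1) (glue (a + 1) (a + 1 + k)) := by
  have hloop : merge (glue a (a + 1 + k)) a (a + 1) a =
      merge (glue a (a + 1 + k)) a (a + 1) (a + 1) := by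
    simp only [merge, glue_apply]; grind
  rw [contractedCount, if_neg (by simp only [glue_apply]; split_ifs <;> omega), ladderCount, ladder,
    treeCount_cons, treeCount_cons, if_pos hloop, add_zero]
  congr 1
  · rw [treeCount_eq_ladderCount (b := a + 1) (by omega) (by omega)]
    · simp only [merge, glue_apply]; grind
    · intro x y hx hy; simp only [merge, glue_apply]; grind
  · rw [contractedCount]
    split_ifs with h1 h2 h2
    · rfl
    · exfalso; simp only [merge, glue_apply] at h1 h2; grind
    · exfalso; simp only [merge, glue_apply] at h1 h2; grind
    · rw [treeCount_eq_ladderCount (b := a + 1) (by omega) (by omega)]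
      · simp only [merge, glue_apply]; grind
      · intro x y hx hy; simp only [merge, glue_apply] at h1 h2 ⊢; grind

/-- The four terms are the subsets of the two edges at `a`: none, first, second, both. Here `a` is
not isolated, being glued to `a + 1 + k`; for `k = 1` the second edge is a loop. -/
theorem ladderCount_glue (a N k : ℕ) (hk : 1 ≤ k) (hkN : k ≤ N + 1) :
    ladderCount a (N + 2) (glue a (a + 1 + k)) =
      ladderCount (a + 1) (N + 1) id + ladderCount (a + 1) (N + 1) (glue (a + 1) (a + 1 + k)) +
      (if k = 1 then 0 else ladderCount (a + 1) (N + 1) (glue (a + 2) (a + 1 + k))) +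
        contractedCount (a + 1) (N + 1) (glue (a + 1) (a + 1 + k)) := by
  have h1 : glue a (a + 1 + k) a ≠ glue a (a + 1 + k) (a + 1) := by
    simp only [glue_apply]; split_ifs <;> omega
  rw [ladderCount, ladder, treeCount_cons, treeCount_cons, treeCount_cons, if_neg h1,
    treeCount_eq_ladderCount (f := glue a (a + 1 + k)) (g := id) (b := a + 1 + k) (by omega)
      (by omega),
    treeCount_eq_ladderCount (f := merge (glue a (a + 1 + k)) a (a + 1))
      (g := glue (a + 1) (a + 1 + k)) (b := a + 1) (by omega) (by omega)]
  · have e1 : (if glue a (a + 1 + k) a = glue a (a + 1 + k) (a + 2) then 0 else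
        treeCount (Finset.Icc a (a + (N + 2))) (ladder (a + 1) (N + 1))
          (merge (glue a (a + 1 + k)) a (a + 2))) =
        if k = 1 then 0 else ladderCount (a + 1) (N + 1) (glue (a + 2) (a + 1 + k)) := by
      split_ifs with h1 h2 h2
      · rfl
      · exfalso; simp only [glue_apply] at h1 h2; grind
      · exfalso; simp only [glue_apply] at h1 h2; grind
      · rw [treeCount_eq_ladderCount (b := a + 2) (by omega) (by omega)]
        · simp only [merge, glue_apply]; grind
        · intro x y hx hy; simp only [merge, glue_apply] at h1 h2 ⊢; grind
    have e2 : (if merge (glue a (a + 1 + k)) a (a + 1) a =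
          merge (glue a (a + 1 + k)) a (a + 1) (a + 2) then 0 else
        treeCount (Finset.Icc a (a + (N + 2))) (ladder (a + 1) (N + 1))
          (merge (merge (glue a (a + 1 + k)) a (a + 1)) a (a + 2))) =
        contractedCount (a + 1) (N + 1) (glue (a + 1) (a + 1 + k)) := by
      rw [contractedCount]
      split_ifs with h1 h2 h2
      · rfl
      · exfalso; simp only [merge, glue_apply] at h1 h2; grind
      · exfalso; simp only [merge, glue_apply] at h1 h2; grind
      · rw [treeCount_eq_ladderCount (b := a + 1) (by omega) (by omega)]
        · simp only [merge, glue_apply]; grind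
        · intro x y hx hy; simp only [merge, glue_apply] at h1 h2 ⊢; grind
    rw [e1, e2]
    ring
  · simp only [merge, glue_apply]; grind
  · intro x y hx hy; simp only [merge, glue_apply]; grind
  · simp only [glue_apply]; grind
  · intro x y hx hy; simp only [glue_apply, id]; grind

end Ladder

/-! ### The closed form and its recurrences -/

section Fibonacci

theorem fib_add' (a b : ℤ) :
    Int.fib (a + b) = (Int.fib (a + 1) - Int.fib a) * Int.fib b + Int.fib a * Int.fib (b + 1) := by
  rw [Int.fib_add]
  have := Int.fib_add_two (a - 1)
  rw [show a - 1 + 2 = a + 1 by ring, show a - 1 + 1 = a by ring] at this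
  rw [this]
  ring

theorem fib_add_add_one (a b : ℤ) :
    Int.fib (a + b + 1) = Int.fib a * Int.fib b + Int.fib (a + 1) * Int.fib (b + 1) := by
  rw [show a + b + 1 = (a + 1) + b by ring, Int.fib_add, show a + 1 - 1 = a by ring]

theorem fib_sub_one (a : ℤ) : Int.fib (a - 1) = Int.fib (a + 1) - Int.fib a := by
  have := Int.fib_add_two (a - 1)
  rw [show a - 1 + 2 = a + 1 by ring, show a - 1 + 1 = a by ring] at this
  rw [this]
  ring

theorem fib_cassini_sq (a : ℤ) :
    (Int.fib (a + 1) ^ 2 - Int.fib a * Int.fib (a + 1) - Int.fib a ^ 2) ^ 2 = 1 := by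
  have h := Int.fib_succ_mul_fib_pred_sub_fib_sq a
  rw [fib_sub_one] at h
  rw [show Int.fib (a + 1) ^ 2 - Int.fib a * Int.fib (a + 1) - Int.fib a ^ 2 = (-1) ^ a.natAbs by
    rw [← h]; ring, ← pow_mul, mul_comm, pow_mul]
  simp

/-- The unsquared identity holds only up to Cassini's sign in `b`; squaring removes it, so the
closed form is a polynomial without parity factors. -/
theorem fib_sub_sq (a b : ℤ) : Int.fib (a - b) ^ 2 =
    (Int.fib a * Int.fib (b + 1) - Int.fib (a + 1) * Int.fib b) ^ 2 := by
  have h1 := fib_add' (a - b) b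
  have h2 := fib_add_add_one (a - b) b
  rw [sub_add_cancel] at h1 h2
  rw [h1, h2]
  linear_combination -Int.fib (a - b) ^ 2 * fib_cassini_sq b

theorem cast_lucas (k : ℕ) : lucas k = 2 * Int.fib (k + 1) - Int.fib k := by
  induction k using Nat.twoStepInduction with
  | zero => simp [lucas]
  | one => simp [lucas, show (1 + 1 : ℤ) = 2 by norm_num]
  | more k ih1 ih2 =>
    rw [lucas, ih1, ih2]
    push_cast
    have h1 := Int.fib_add_two k
    have h2 := Int.fib_add_two (k + 1)
    rw [show (k : ℤ) + 1 + 1 = k + 2 by ring] at *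
    rw [show (k : ℤ) + 2 + 1 = k + 1 + 2 by ring, h2, h1]
    ring

/-- The closed form of the number of separating forests of the straight linear 2-tree when `j`
vertices precede the first of the two vertices, `k` is their distance, and `r` vertices follow the
second one. -/
noncomputable def forestFormula (j k r : ℤ) : ℚ :=
  (Int.fib (j + k + r) : ℚ) ^ 2 + (Int.fib k : ℚ) ^ 2 * (Int.fib (r - j) : ℚ) ^ 2
    + (Int.fib (j + k + r) : ℚ) / 5
      * ((Int.fib (j + r - 1) : ℚ) * ((k : ℚ) * (2 * Int.fib (k + 1) - Int.fib k) - Int.fib k)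
        + (Int.fib (j + r) : ℚ)
          * (((k : ℚ) - 5) * Int.fib (k + 1) + (2 * (k : ℚ) + 2) * Int.fib k))

/-- `forestFormula` as a polynomial in neighbouring Fibonacci numbers. -/
def forestPoly (k x y p q s t : ℚ) : ℚ :=
  (x * (s * p + t * q) + (y - x) * ((t - s) * p + s * q)) ^ 2 + x ^ 2 * (p * t - q * s) ^ 2
    + (x * (s * p + t * q) + (y - x) * ((t - s) * p + s * q)) / 5
      * ((s * p + t * q - ((t - s) * p + s * q)) * (k * (2 * y - x) - x)
        + ((t - s) * p + s * q) * ((k - 5) * y + (2 * k + 2) * x))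

theorem forestFormula_eq (j k r : ℤ) : forestFormula j k r =
    forestPoly k (Int.fib k) (Int.fib (k + 1)) (Int.fib r) (Int.fib (r + 1)) (Int.fib j)
      (Int.fib (j + 1)) := by
  have h : (Int.fib (r - j) : ℚ) ^ 2 = ((Int.fib r : ℚ) * Int.fib (j + 1)
      - Int.fib (r + 1) * Int.fib j) ^ 2 := by exact_mod_cast fib_sub_sq r j
  rw [forestFormula, forestPoly, h, show j + k + r = k + (j + r) by ring, fib_add' k (j + r),
    fib_sub_one, fib_add_add_one j r, fib_add' j r]
  push_cast
  ring

theorem fib_succ_succ (a : ℤ) : Int.fib (a + 1 + 1) = Int.fib a + Int.fib (a + 1) := by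
  rw [add_assoc]
  exact Int.fib_add_two a

/-- This is what remains of `ladderCount_succ` and `contractedCount_succ` after eliminating the
contracted count. -/
theorem forestFormula_add_two (j k r : ℤ) : forestFormula (j + 1 + 1) k r =
    3 * forestFormula (j + 1) k r - forestFormula j k r := by
  simp only [forestFormula_eq, forestPoly, fib_succ_succ]
  push_cast
  ring

theorem forestFormula_one_right (r : ℤ) :
    forestFormula 0 1 r = Int.fib (r + 1) ^ 2 + Int.fib r ^ 2 := by
  simp only [forestFormula_eq, forestPoly, show (1 + 1 : ℤ) = 2 by norm_num, zero_add,
    Int.fib_zero, Int.fib_one, Int.fib_two]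
  push_cast
  ring

theorem forestFormula_one_one (r : ℤ) : forestFormula 1 1 r = 2 * forestFormula 0 1 r := by
  simp only [forestFormula_eq, forestPoly, show (1 + 1 : ℤ) = 2 by norm_num, zero_add,
    Int.fib_zero, Int.fib_one, Int.fib_two]
  push_cast
  ring

theorem forestFormula_one_zero (r : ℤ) : forestFormula 1 0 r = 0 := by
  simp only [forestFormula_eq, forestPoly, show (1 + 1 : ℤ) = 2 by norm_num, zero_add,
    Int.fib_zero, Int.fib_one, Int.fib_two]
  push_cast
  ring

/-- Mirrors `ladderCount_glue`: the first term counts trees of the unglued 2-tree, and the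
contracted count is written as `forestFormula 1 (k + 1) r - 2 * forestFormula 0 (k + 1) r`. -/
theorem forestFormula_zero_succ (k r : ℤ) : forestFormula 0 (k + 1 + 1) r =
    Int.fib (2 * (k + 1 + r)) + forestFormula 1 (k + 1) r - forestFormula 0 (k + 1) r
      + forestFormula 1 k r := by
  rw [Int.fib_two_mul, fib_add_add_one, fib_add' (k + 1)]
  simp only [forestFormula_eq, forestPoly, show (1 + 1 : ℤ) = 2 by norm_num, zero_add,
    Int.fib_zero, Int.fib_one, Int.fib_two, fib_succ_succ]
  push_cast
  ring

theorem forestFormula_one_succ (k r : ℤ) : forestFormula 1 (k + 1) r =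
    2 * forestFormula 0 (k + 1) r + forestFormula 1 k r - forestFormula 0 k r := by
  simp only [forestFormula_eq, forestPoly, show (1 + 1 : ℤ) = 2 by norm_num, zero_add,
    Int.fib_zero, Int.fib_one, Int.fib_two, fib_succ_succ]
  push_cast
  ring

theorem forestFormula_zero (j r : ℤ) : forestFormula j 0 r = 0 := by
  simp only [forestFormula_eq, forestPoly, zero_add, Int.fib_zero, Int.fib_one]
  push_cast
  ring

/-- The telescoping step: moving the second vertex one place right, with the total fixed,
contributes one summand. -/
theorem forestFormula_succ_sub (j k r : ℤ) : forestFormula j (k + 1) r =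
    forestFormula j k (r + 1) +
      ((Int.fib (k + 1) * Int.fib (k + 1 + 2 * j) - Int.fib k * Int.fib (k + 2 * j))
        * Int.fib (2 * r + 1) : ℤ) := by
  rw [fib_add' (k + 1) (2 * j), fib_add' k (2 * j), Int.fib_two_mul, Int.fib_two_mul_add_one,
    Int.fib_two_mul_add_one]
  simp only [forestFormula_eq, forestPoly, fib_succ_succ]
  push_cast
  ring

theorem sum_eq_forestFormula (m j : ℤ) (k : ℕ) :
    ((∑ i ∈ Finset.Icc 1 k,
        (Int.fib i * Int.fib (i + 2 * j - 2) - Int.fib (i - 1) * Int.fib (i + 2 * j - 3))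
          * Int.fib (2 * m - 2 * i - 2 * j + 5) : ℤ) : ℚ) =
      forestFormula (j - 1) k (m + 2 - j - k) := by
  induction k with
  | zero => simp [forestFormula_zero]
  | succ k ih =>
    rw [Finset.sum_Icc_succ_top (by omega), Int.cast_add, ih]
    push_cast
    rw [forestFormula_succ_sub, show m + 2 - j - ((k : ℤ) + 1) + 1 = m + 2 - j - k by ring,
      show (k : ℤ) + 1 + 2 * (j - 1) = k + 1 + 2 * j - 2 by ring,
      show (k : ℤ) + 2 * (j - 1) = k + 1 + 2 * j - 3 by ring,
      show 2 * (m + 2 - j - ((k : ℤ) + 1)) + 1 = 2 * m - 2 * (k + 1) - 2 * j + 5 by ring,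
      add_sub_cancel_right]
    push_cast
    rfl

end Fibonacci

/-! ### Matching the counts with the closed form -/

section Counts

theorem id_isolated (a x : ℕ) (hx : a < x) : id x ≠ id a := by
  simp only [id]; omega

theorem count_id (N : ℕ) : ∀ a : ℕ,
    (ladderCount a (N + 1) id : ℤ) = Int.fib (2 * (N + 1)) ∧
      (contractedCount a (N + 1) id : ℤ) = Int.fib (2 * N + 1) := by
  induction N with
  | zero =>
    intro a
    have h1 : (a : ℕ) ≠ a + 1 := by omega
    have h2 : (∀ x ∈ Finset.Icc a (a + 1), ∀ y ∈ Finset.Icc a (a + 1),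
        merge id a (a + 1) x = merge id a (a + 1) y) := by
      intro x hx y hy
      rw [Finset.mem_Icc] at hx hy
      simp only [merge, id]
      split_ifs <;> omega
    have h3 : ¬ (∀ x ∈ Finset.Icc a (a + 1), ∀ y ∈ Finset.Icc a (a + 1), id x = id y) := by
      intro h
      have := h a (by simp) (a + 1) (by simp)
      simp at this
    constructor
    · rw [ladderCount, zero_add, ladder, treeCount_cons, treeCount, treeCount, if_neg h3,
        if_neg (by simp), if_pos h2]
      simp
    · have h4 : merge id a (a + 1) a = merge id a (a + 1) (a + 1) := by simp [merge]
      rw [contractedCount, if_neg (by simp), ladderCount, zero_add, ladder, treeCount_cons,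
        treeCount, if_pos h2, if_pos h4]
      simp
  | succ N ih =>
    intro a
    rw [ladderCount_succ a N (id_isolated a), contractedCount_succ a N (id_isolated a)]
    obtain ⟨h1, h2⟩ := ih (a + 1)
    have e1 := Int.fib_add_two (2 * N + 1)
    have e2 := Int.fib_add_two (2 * N + 2)
    rw [show (2 * N + 1 + 2 : ℤ) = 2 * (N + 1) + 1 by ring,
      show (2 * N + 1 + 1 : ℤ) = 2 * (N + 1) by ring] at e1
    rw [show (2 * N + 2 + 2 : ℤ) = 2 * (N + 1 + 1) by ring,
      show (2 * N + 2 + 1 : ℤ) = 2 * (N + 1) + 1 by ring,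
      show (2 * N + 2 : ℤ) = 2 * (N + 1) by ring] at e2
    push_cast
    rw [h1, h2, e2, e1]
    constructor <;> ring

/-- The third clause, a pair at distance `k` behind one extra vertex, is carried along because
choosing only the second edge at `a` produces it. For `k = 0` the pair coincides and nothing
separates it. -/
theorem count_glue (r k : ℕ) : ∀ a : ℕ,
    (ladderCount a (k + 1 + r) (glue a (a + 1 + k)) : ℚ) = forestFormula 0 (k + 1) r ∧
    (contractedCount a (k + 1 + r) (glue a (a + 1 + k)) : ℚ) =
      forestFormula 1 (k + 1) r - 2 * forestFormula 0 (k + 1) r ∧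
    (if k = 0 then 0 else (ladderCount a (k + 1 + r) (glue (a + 1) (a + 1 + k)) : ℚ)) =
      forestFormula 1 k r := by
  induction k with
  | zero =>
    intro a
    rw [if_pos rfl, add_zero, ladderCount_glue_succ_self, contractedCount_glue_succ_self,
      zero_add, add_comm 1 r]
    simp only [Nat.cast_zero, zero_add]
    rw [forestFormula_one_one, forestFormula_one_zero, forestFormula_one_right,
      show (contractedCount a (r + 1) id : ℚ) = ((contractedCount a (r + 1) id : ℤ) : ℚ) by
        push_cast; rfl, (count_id r a).2, Int.fib_two_mul_add_one]
    push_cast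
    simp
  | succ k ih =>
    intro a
    obtain ⟨h1, h2, h3⟩ := ih (a + 1)
    have eN : k + 1 + 1 + r = (k + r) + 2 := by ring
    have eN' : k + 1 + r = (k + r) + 1 := by ring
    have ev : a + 1 + (k + 1) = a + 1 + 1 + k := by ring
    have hid := (count_id (k + r) (a + 1)).1
    have hid' : (ladderCount (a + 1) (k + r + 1) id : ℚ) = (Int.fib (2 * (k + 1 + r)) : ℚ) := by
      rw [show (k + 1 + r : ℤ) = ((k + r : ℕ) : ℤ) + 1 by push_cast; ring, ← hid]
      push_cast; rfl
    rw [eN'] at h1 h2 h3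
    rw [eN, ladderCount_glue a (k + r) (k + 1) (by omega) (by omega),
      contractedCount_glue a (k + r) (k + 1) (by omega),
      ladderCount_succ a (k + r) (glue_isolated (by omega) (by omega)), ev,
      if_neg (Nat.succ_ne_zero k)]
    have h3' : ((if k + 1 = 1 then 0 else
        ladderCount (a + 1) (k + r + 1) (glue (a + 2) (a + 1 + 1 + k)) : ℕ) : ℚ) =
        forestFormula 1 k r := by
      rw [← h3]
      by_cases hk : k = 0 <;> simp [hk]
    rw [Nat.cast_add, Nat.cast_add, Nat.cast_add, h3', hid', h1, h2]
    push_cast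
    rw [h1, h2]
    refine ⟨?_, ?_, ?_⟩
    · rw [forestFormula_zero_succ]; ring
    · have := forestFormula_one_succ (k + 1) r
      rw [this]; ring
    · ring

theorem count_prefix (r k j : ℕ) : ∀ a : ℕ,
    (ladderCount a (j + (k + 1) + r) (glue (a + j) (a + j + 1 + k)) : ℚ) =
      forestFormula j (k + 1) r ∧
    (contractedCount a (j + (k + 1) + r) (glue (a + j) (a + j + 1 + k)) : ℚ) =
      forestFormula (j + 1) (k + 1) r - 2 * forestFormula j (k + 1) r := by
  induction j with
  | zero =>
    intro a
    simpa using ⟨(count_glue r k a).1, (count_glue r k a).2.1⟩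
  | succ j ih =>
    intro a
    obtain ⟨h1, h2⟩ := ih (a + 1)
    rw [show j + 1 + (k + 1) + r = (j + k + r) + 2 by ring]
    rw [show j + (k + 1) + r = (j + k + r) + 1 by ring,
      show a + 1 + j = a + (j + 1) by ring] at h1 h2
    have hiso := glue_isolated (a := a) (u := a + (j + 1)) (v := a + (j + 1) + 1 + k)
      (by omega) (by omega)
    rw [ladderCount_succ _ _ hiso, contractedCount_succ _ _ hiso]
    push_cast
    rw [h1, h2, forestFormula_add_two]
    constructor <;> ring

end Counts

/-! ### Transfer to `Fin` and conclusion -/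

theorem exists_map_val_eq {n : ℕ} (l : List (ℕ × ℕ)) (hl : ∀ p ∈ l, p.1 < n ∧ p.2 < n) :
    ∃ L : List (Fin n × Fin n), L.map (Prod.map Fin.valEmbedding Fin.valEmbedding) = l := by
  induction l with
  | nil => exact ⟨[], rfl⟩
  | cons p l ih =>
    obtain ⟨L, hL⟩ := ih fun q hq => hl q (List.mem_cons_of_mem _ hq)
    obtain ⟨h1, h2⟩ := hl p List.mem_cons_self
    exact ⟨(⟨p.1, h1⟩, ⟨p.2, h2⟩) :: L, by
      rw [List.map_cons, hL]; rfl⟩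

theorem numSeparatingTwoForests_eq_ladderCount (N : ℕ) (u v : Fin (N + 1)) (huv : u ≠ v) :
    numSeparatingTwoForests (straightLinearTwoTree (N + 1)) u v =
      ladderCount 0 N (glue u v) := by
  obtain ⟨L, hL⟩ := exists_map_val_eq (n := N + 1) (ladder 0 N) fun p hp => by
    rw [mem_ladder] at hp
    omega
  have hmem : ∀ x y : Fin (N + 1), (x, y) ∈ L ↔
      (y : ℕ) = x + 1 ∨ (y : ℕ) = x + 2 := by
    intro x y
    have h1 : (x, y) ∈ L ↔ ((x : ℕ), (y : ℕ)) ∈ ladder 0 N := by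
      rw [← hL, List.mem_map]
      constructor
      · exact fun h => ⟨_, h, rfl⟩
      · rintro ⟨⟨x', y'⟩, h, e⟩
        simp only [Prod.map, Fin.valEmbedding_apply, Prod.mk.injEq] at e
        rwa [← Fin.ext e.1, ← Fin.ext e.2]
    rw [h1, mem_ladder]
    have := y.isLt
    dsimp only
    omega
  have hset : {H : SimpleGraph (Fin (N + 1)) |
      IsSpanningTwoForest (straightLinearTwoTree (N + 1)) H ∧
        H.connectedComponentMk u ≠ H.connectedComponentMk v} = forestsBetween u v ⊥ L := by
    ext H
    rw [Set.mem_ofPred_eq, isSpanningTwoForest_and_ne_iff, forestsBetween, Set.mem_ofPred_eq]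
    refine and_congr_right fun _ => ?_
    simp only [bot_le, true_and, bot_adj, false_or, hmem]
    refine forall₂_congr fun x y => imp_congr_right fun _ => ?_
    change (_ ∨ _ ∨ _ ∨ _) ↔ _
    omega
  have huniv : (Finset.univ : Finset (Fin (N + 1))).map Fin.valEmbedding = Finset.Icc 0 (0 + N) := by
    ext x
    simp only [Finset.mem_map, Finset.mem_univ, true_and, Fin.valEmbedding_apply, Finset.mem_Icc]
    constructor
    · rintro ⟨y, rfl⟩
      omega
    · intro h
      exact ⟨⟨x, by omega⟩, rfl⟩
  rw [numSeparatingTwoForests, hset, ladderCount, ← hL, ← huniv, treeCount_map]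
  refine ncard_forestsBetween u v L ⊥ _ ?_ ?_ isAcyclic_bot ?_ ?_
  · have hnd : L.Nodup := List.Nodup.of_map _ (hL ▸ nodup_ladder N 0)
    -- Listed pairs are increasing, so no edge appears in both orientations.
    refine (List.nodup_map_iff_inj_on hnd).2 ?_
    rintro ⟨x, y⟩ h1 ⟨z, w⟩ h2 e
    rw [hmem] at h1 h2
    rcases Sym2.eq_iff.1 e with ⟨h, h'⟩ | ⟨h, h'⟩
    · exact Prod.ext h h'
    · dsimp only at h h'
      subst h h'
      omega
  · rintro ⟨x, y⟩ h
    rw [hmem] at h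
    refine ⟨fun e => ?_, id⟩
    dsimp only at e
    subst e
    omega
  · rwa [reachable_bot]
  · intro x y
    rw [reachable_sup_edge_iff]
    simp only [reachable_bot, Function.comp_apply, glue_apply, Fin.valEmbedding_apply, Fin.ext_iff]
    rw [Ne, Fin.ext_iff] at huv
    split_ifs <;> omega

end StraightTwoTree

theorem mainTheorem6 (m j k : ℕ) (hj : 1 ≤ j) (hk : 1 ≤ k) (hjk : j + k ≤ m + 2) :
    (StraightTwoTree.numSeparatingTwoForests (StraightTwoTree.straightLinearTwoTree (m + 2))
        ⟨j - 1, by omega⟩ ⟨j + k - 1, by omega⟩ : ℤ)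
      = ∑ i ∈ Finset.Icc 1 k,
          (Int.fib i * Int.fib (i + 2 * j - 2) - Int.fib (i - 1) * Int.fib (i + 2 * j - 3))
            * Int.fib (2 * m - 2 * i - 2 * j + 5) ∧
    ((∑ i ∈ Finset.Icc 1 k,
          (Int.fib i * Int.fib (i + 2 * j - 2) - Int.fib (i - 1) * Int.fib (i + 2 * j - 3))
            * Int.fib (2 * m - 2 * i - 2 * j + 5) : ℤ) : ℚ)
      = (Int.fib (m + 1) : ℚ) ^ 2
        + (Int.fib k : ℚ) ^ 2 * (Int.fib (m - 2 * j - k + 3) : ℚ) ^ 2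
        + (Int.fib (m + 1) : ℚ) / 5
          * ((Int.fib (m - k) : ℚ) * ((k : ℚ) * (StraightTwoTree.lucas k : ℚ) - (Int.fib k : ℚ))
            + (Int.fib (m - k + 1) : ℚ)
              * (((k : ℚ) - 5) * (Int.fib (k + 1) : ℚ) + (2 * (k : ℚ) + 2) * (Int.fib k : ℚ))) := by
  have hsum := StraightTwoTree.sum_eq_forestFormula m j k
  refine ⟨?_, ?_⟩
  · rw [← @Int.cast_inj ℚ, hsum]
    -- After these shifts `j` counts the vertices before the first chosen one, the distance is `k +
    -- 1`, and `r` counts the vertices after the second.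
    obtain ⟨j, rfl⟩ := Nat.exists_eq_add_of_le' hj
    obtain ⟨k, rfl⟩ := Nat.exists_eq_add_of_le' hk
    obtain ⟨r, hr⟩ := Nat.exists_eq_add_of_le hjk
    obtain rfl : m = j + k + r := by omega
    rw [StraightTwoTree.numSeparatingTwoForests_eq_ladderCount (j + k + r + 1) _ _
      (by rw [Ne, Fin.ext_iff]; dsimp only; omega)]
    have h := (StraightTwoTree.count_prefix r k j 0).1
    rw [show j + (k + 1) + r = j + k + r + 1 by ring, zero_add] at h
    simp only [add_tsub_cancel_right, show j + 1 + (k + 1) - 1 = j + 1 + k by omega]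
    rw [Int.cast_natCast, h]
    congr 1 <;> push_cast <;> ring
  · rw [hsum, StraightTwoTree.forestFormula, StraightTwoTree.cast_lucas]
    rw [show (j : ℤ) - 1 + k + (m + 2 - j - k) = m + 1 by ring,
      show (m : ℤ) + 2 - j - k - (j - 1) = m - 2 * j - k + 3 by ring,
      show (j : ℤ) - 1 + (m + 2 - j - k) - 1 = m - k by ring,
      show (j : ℤ) - 1 + (m + 2 - j - k) = m - k + 1 by ring]
    push_cast
    rfl
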